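/- Model. In the congested clique with $n$ nodes, in each synchronous round every node may send a (possibly different) message of $O(\log n)$ bits to each other node; local computation is free and the complexity of a deterministic protocol is its number of rounds. The message length is $c\lceil\log_2 n\rceil$ bits for an arbitrary fixed integer $c\ge 1$. For a field $\mathbb F$, in both of the following problems node $\ell\in\{1,\dots,n\}$ initially knows the $\ell$-th row and the $\ell$-th column of a matrix $A\in\mathbb F^{n\times n}$. In $\mathrm{DET}(n,\mathbb F)$ every node must output $\det A$. In $\mathrm{INV}(n,\mathbb F)$ the matrix $A$ is invertible and node $\ell$ must output the $\ell$-th row and the $\ell$-th column of $A^{-1}$. Exponent. An algebraic algorithm of rank $t$ for $d\times d$ matrix multiplication over $\mathbb F$ consists of coefficients $\alpha_{ij\mu},\beta_{ij\mu},\lambda_{ij\mu}\in\mathbb F$ ($1\le i,j\le d$, $1\le\mu\le t$) with $(AB)_{ij}=\sum_{\mu}\lambda_{ij\mu}\bigl(\sum_{i',j'}\alpha_{i'j'\mu}A_{i'j'}\bigr)\bigl(\sum_{i',j'}\beta_{i'j'\mu}B_{j'i'}\bigr)$ for all $A,B\in\mathbb F^{d\times d}$. For a family $\mathcal F$ of fields,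 a real number $\tau$ is called admissible if there is a constant $K$ such that for all $d\ge1$ and all $\mathbb F\in\mathcal F$ there is such an algorithm of rank at most $Kd^{\tau}$, and $\omega=\omega(\mathcal F)$ is the infimum of the admissible $\tau$. Theorem. Let $P$ be a polynomial and let $(n_i,\mathbb F_i)_{i\in I}$ be any family of positive integers $n_i$ and finite fields $\mathbb F_i$ of order at most $P(n_i)$ and of characteristic greater than $n_i$; let $\omega$ be the exponent of the family $(\mathbb F_i)_{i\in I}$. Then the deterministic round complexity, in the congested clique with $n_i$ nodes, of $\mathrm{DET}(n_i,\mathbb F_i)$ and of $\mathrm{INV}(n_i,\mathbb F_i)$ is $O(n_i^{1-1/\omega})$, where, as usual, an $o(1)$ in the exponent is ignored. Precisely: for every admissible $\tau$ there is a constant $C$ such that for all $i\in I$ both complexities are at most $C\,n_i^{1-1/\tau}$ (the constants $C$ may depend on $c$); and for every $\varepsilon>0$ there is a constant $C$ such that for all $i\in I$ both complexities are at most $C\,n_i^{1-1/\omega+\varepsilon}$. -/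

import Mathlib

open scoped Matrix

/-- A message of `b` bits. -/
abbrev Message (b : ℕ) : Type := Fin b → Bool

/-- What a node has received so far: one entry per elapsed round (oldest first), the entry of a round
giving for every sender `u` the message received from `u` in that round. -/
abbrev Inbox (n b : ℕ) : Type := List (Fin n → Message b)

/-- A deterministic protocol for the congested clique with `n` nodes and messages of `b` bits.
In each synchronous round every node sends a message of `b` bits to every node (different receivers
may get different messages).  Local computation is unrestricted, so a message is an arbitrary
function of the sender, the sender's own input, everything the sender has received in the earlier
rounds, and the receiver; the local output is an arbitrary function of the node, its input and
everything that it has received. -/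
structure CliqueProtocol (n b : ℕ) (In Out : Type*) where
  /-- `message u x h v` is what node `u`, with input `x` and inbox `h`, sends to node `v`. -/
  message : Fin n → In → Inbox n b → Fin n → Message b
  /-- `output u x h` is the output of node `u` with input `x` and final inbox `h`. -/
  output : Fin n → In → Inbox n b → Out

namespace CliqueProtocol

variable {n b : ℕ} {In Out : Type*}

/-- The inbox of every node after `t` rounds, when node `u` has input `x u`. -/
def inbox (p : CliqueProtocol n b In Out) (x : Fin n → In) : ℕ → Fin n → Inbox n b
  | 0, _ => []
  | t + 1, v => inbox p x t v ++ [fun u => p.message u (x u) (inbox p x t u) v]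

/-- The output of node `v` when the protocol is stopped after `T` rounds. -/
def result (p : CliqueProtocol n b In Out) (x : Fin n → In) (T : ℕ) (v : Fin n) : Out :=
  p.output v (x v) (p.inbox x T v)

end CliqueProtocol

/-- Distribution of a matrix among the nodes: node `v` has the `v`-th row and the `v`-th column. -/
def rowCol {n : ℕ} {F : Type*} (A : Matrix (Fin n) (Fin n) F) (v : Fin n) :
    (Fin n → F) × (Fin n → F) :=
  (fun j => A v j, fun i => A i v)

/-- Some deterministic protocol with `b`-bit messages computes, in `T` rounds, the determinant of
every `n × n` matrix over `F`: every node ends up with the determinant. -/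
def DetInRounds (n b : ℕ) (F : Type*) [Field F] (T : ℕ) : Prop :=
  ∃ p : CliqueProtocol n b ((Fin n → F) × (Fin n → F)) F,
    ∀ (A : Matrix (Fin n) (Fin n) F) (v : Fin n), p.result (rowCol A) T v = A.det

/-- Some deterministic protocol with `b`-bit messages computes, in `T` rounds, the inverse of
every invertible `n × n` matrix over `F`: node `v` ends up with the `v`-th row and the `v`-th column
of the inverse. -/
def InvInRounds (n b : ℕ) (F : Type*) [Field F] (T : ℕ) : Prop :=
  ∃ p : CliqueProtocol n b ((Fin n → F) × (Fin n → F)) ((Fin n → F) × (Fin n → F)),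
    ∀ A : Matrix (Fin n) (Fin n) F, IsUnit A →
      ∀ v : Fin n, p.result (rowCol A) T v = rowCol A⁻¹ v

/-- There is an algebraic (bilinear) algorithm of rank `t` for the product of an `n × m` matrix by
an `m × n` matrix over `F`. -/
def HasMatMulAlgorithm (F : Type*) [Field F] (n m t : ℕ) : Prop :=
  ∃ (α β : Fin n → Fin m → Fin t → F) (γ : Fin n → Fin n → Fin t → F),
    ∀ (A : Matrix (Fin n) (Fin m) F) (B : Matrix (Fin m) (Fin n) F) (i j : Fin n),
      (A * B) i j = ∑ μ, γ i j μ *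
        (∑ i', ∑ j', α i' j' μ * A i' j') * (∑ i', ∑ j', β i' j' μ * B j' i')

/-- The real numbers `τ` such that `d × d` matrices over the fields `F i` can be multiplied by
algebraic algorithms of rank `O(d ^ τ)`, with the same implied constant for all `i`. -/
def matMulExponents {ι : Type*} (F : ι → Type*) [∀ i, Field (F i)] : Set ℝ :=
  {τ | ∃ K : ℝ, ∀ i, ∀ d : ℕ, 1 ≤ d →
    ∃ t : ℕ, (t : ℝ) ≤ K * (d : ℝ) ^ τ ∧ HasMatMulAlgorithm (F i) d d t}

/-- The exponent `ω` of square matrix multiplication over the family of fields `F` (over a single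
field, if the family has one member). -/
noncomputable def matMulOmega {ι : Type*} (F : ι → Type*) [∀ i, Field (F i)] : ℝ :=
  sInf (matMulExponents F)

/-! Let `h` be a power of two between √n and 2√n. Every exponent below `h * h`, hence below n, is `i
+ h * j` with `i, j < h`, so the powers of A up to `h` and those of `A ^ h` suffice (baby steps and
giant steps). Each list comes from repeated doubling. The traces of all A^(i+1)(A^h)^j then take a
constant number of symbol transmissions per link. Newton's identities turn them into the
characteristic polynomial (`Matrix.charpoly_eq_of_trace_pow_eq`; characteristic above n permits the
divisions), which contains the determinant. Cayley–Hamilton gives the inverse as Σ_j (A^h)^j B_j,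
where B_j is a known combination of small powers: `h` further products.

The cost lies in `k` simultaneous products (`Reach.matMul`). Take `d` with k·d^τ ≈ n: a rank O(d^τ)
algorithm on d × d block matrices creates O(n) block products, O(1) per node, each on blocks with
about n²/d² entries. Balanced routing takes O(n/d²) = O(n(k/n)^(2/τ)) rounds. Over the doublings
this is a geometric sum dominated by k ≈ √n, namely O(n^(1-1/τ)).

Protocols are handled through indistinguishability: `Reach` records what a node's view determines,
and local computation amounts to showing that a quantity is constant on equal views. -/

namespace CliqueProtocol

variable {n b : ℕ} {In Out Out' : Type*}

theorem length_inbox (p : CliqueProtocol n b In Out) (x : Fin n → In) (t : ℕ) (v : Fin n) :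
    (p.inbox x t v).length = t := by
  induction t with
  | zero => rfl
  | succ t ih => simp [inbox, ih]

/-- The length of an inbox is a clock, so a protocol can be altered from round `T` on without
disturbing its past. -/
theorem inbox_congr (p : CliqueProtocol n b In Out) (q : CliqueProtocol n b In Out')
    (x : Fin n → In) (T : ℕ)
    (h : ∀ u z l, l.length < T → p.message u z l = q.message u z l) :
    ∀ t ≤ T, ∀ v, p.inbox x t v = q.inbox x t v := by
  intro t
  induction t with
  | zero => intros; rfl
  | succ t ih =>
    intro ht v
    simp only [inbox, ih (by omega)]
    congr 2
    funext u
    rw [h u _ _ (by rw [length_inbox]; omega)]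

end CliqueProtocol

/-! ### Protocols as growing knowledge -/

/-- After `T` rounds of some protocol, whenever node `v` cannot tell the global inputs `x` and `y`
apart, they satisfy `J v x y`.  Node `v` initially sees `f x v` of the global input `x`. -/
def Reach (n b : ℕ) {X In : Type*} (f : X → Fin n → In) (T : ℕ)
    (J : Fin n → X → X → Prop) : Prop :=
  ∃ p : CliqueProtocol n b In PUnit.{1}, ∀ v x y,
    f x v = f y v → p.inbox (f x) T v = p.inbox (f y) T v → J v x y

namespace Reach

variable {n b : ℕ} {X In : Type*} {f : X → Fin n → In} {T : ℕ} {J J' : Fin n → X → X → Prop}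

theorem zero (f : X → Fin n → In) : Reach n b f 0 (fun v x y => f x v = f y v) :=
  ⟨⟨fun _ _ _ _ _ => false, fun _ _ _ => ⟨⟩⟩, fun _ _ _ h _ => h⟩

theorem mono (h : Reach n b f T J) (hJ : ∀ v x y, J v x y → J' v x y) : Reach n b f T J' :=
  let ⟨p, hp⟩ := h
  ⟨p, fun v x y h₁ h₂ => hJ v x y (hp v x y h₁ h₂)⟩

/-- What a node can determine, it can output. -/
theorem exists_result {Out : Type*} [Nonempty Out] {g : X → Fin n → Out}
    (h : Reach n b f T (fun v x y => g x v = g y v)) :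
    ∃ p : CliqueProtocol n b In Out, ∀ x v, p.result (f x) T v = g x v := by
  classical
  obtain ⟨p, hp⟩ := h
  -- The node picks any global input consistent with its view; the hypothesis makes the answer
  -- independent of the choice.
  refine ⟨⟨p.message, fun v z l =>
    if h : ∃ x, f x v = z ∧ p.inbox (f x) T v = l then g h.choose v else Classical.arbitrary Out⟩,
    fun x v => ?_⟩
  have e := CliqueProtocol.inbox_congr p ⟨p.message, fun v z l =>
    if h : ∃ x, f x v = z ∧ p.inbox (f x) T v = l then g h.choose v else Classical.arbitrary Out⟩
    (f x) T (fun _ _ _ _ => rfl) T le_rfl v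
  have hx : ∃ x', f x' v = f x v ∧ p.inbox (f x') T v = p.inbox (f x) T v := ⟨x, rfl, rfl⟩
  simp only [CliqueProtocol.result]
  rw [← e, dif_pos hx]
  exact hp v _ _ hx.choose_spec.1 hx.choose_spec.2

/-- One more round, in which every node sends messages that it can determine. -/
theorem succ (h : Reach n b f T J) (m : X → Fin n → Fin n → Message b)
    (hm : ∀ u x y, J u x y → m x u = m y u) :
    Reach n b f (T + 1) (fun v x y => J v x y ∧ ∀ u, m x u v = m y u v) := by
  classical
  obtain ⟨p, hp⟩ := h
  let q : CliqueProtocol n b In PUnit.{1} := ⟨fun u z l =>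
    if l.length < T then p.message u z l else
      if h : ∃ x, f x u = z ∧ p.inbox (f x) T u = l then m h.choose u else fun _ _ => false,
    fun _ _ _ => ⟨⟩⟩
  have hq : ∀ x v, p.inbox (f x) T v = q.inbox (f x) T v := fun x v =>
    CliqueProtocol.inbox_congr p q (f x) T (fun u z l hl => by simp [q, hl]) T le_rfl v
  have hmsg : ∀ x u, q.message u (f x u) (q.inbox (f x) T u) = m x u := by
    intro x u
    have hx : ∃ x', f x' u = f x u ∧ p.inbox (f x') T u = p.inbox (f x) T u := ⟨x, rfl, rfl⟩
    rw [← hq]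
    simp only [q, CliqueProtocol.length_inbox, lt_irrefl, if_false]
    rw [dif_pos hx]
    exact hm u _ _ (hp u _ _ hx.choose_spec.1 hx.choose_spec.2)
  refine ⟨q, fun v x y h₁ h₂ => ?_⟩
  simp only [CliqueProtocol.inbox, hmsg] at h₂
  obtain ⟨h₃, h₄⟩ := List.append_inj' h₂ rfl
  refine ⟨hp v x y h₁ (by rw [hq, hq, h₃]), fun u => ?_⟩
  exact congrFun (List.singleton_inj.1 h₄) u

/-- Waiting. -/
theorem add (h : Reach n b f T J) (k : ℕ) : Reach n b f (T + k) J := by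
  induction k with
  | zero => exact h
  | succ k ih => exact (ih.succ (fun _ _ _ _ => false) (fun _ _ _ _ => rfl)).mono fun _ _ _ h => h.1

theorem le (h : Reach n b f T J) {T' : ℕ} (hT : T ≤ T') : Reach n b f T' J := by
  obtain ⟨k, rfl⟩ := Nat.exists_eq_add_of_le hT
  exact h.add k

/-- Sending `k` messages along every link. -/
theorem send (h : Reach n b f T J) (k : ℕ) (m : X → Fin n → Fin n → Fin k → Message b)
    (hm : ∀ u x y, J u x y → m x u = m y u) :
    Reach n b f (T + k) (fun v x y => J v x y ∧ ∀ u, m x u v = m y u v) := by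
  induction k with
  | zero => exact h.mono fun v x y hJ => ⟨hJ, fun u => Subsingleton.elim _ _⟩
  | succ k ih =>
    have := (ih (fun x u v i => m x u v i.castSucc)
      (fun u x y hJ => by simp only [hm u x y hJ])).succ (fun x u v => m x u v (Fin.last k))
      (fun u x y hJ => by simp only [hm u x y hJ.1])
    refine this.mono fun v x y hJ => ⟨hJ.1.1, fun u => funext fun i => ?_⟩
    induction i using Fin.lastCases with
    | last => exact hJ.2 u
    | cast i => exact congrFun (hJ.1.2 u) i

/-- Sending `k` elements of a finite set along every link, each by means of `s` messages. -/
theorem sendSymbols {S : Type*} [Finite S] {s : ℕ} (hs : Nat.card S ≤ 2 ^ (b * s))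
    (h : Reach n b f T J) (k : ℕ) (m : X → Fin n → Fin n → Fin k → S)
    (hm : ∀ u x y, J u x y → m x u = m y u) :
    Reach n b f (T + s * k) (fun v x y => J v x y ∧ ∀ u, m x u v = m y u v) := by
  classical
  have := Fintype.ofFinite S
  obtain ⟨enc⟩ : Nonempty (S ↪ (Fin s → Message b)) := by
    apply Function.Embedding.nonempty_of_card_le
    rw [← Nat.card_eq_fintype_card]
    refine hs.trans_eq ?_
    simp [pow_mul]
  have := h.send (s * k) (fun x u v i => enc (m x u v (finProdFinEquiv.symm i).2)
    (finProdFinEquiv.symm i).1) (fun u x y hJ => by simp only [hm u x y hJ])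
  refine this.mono fun v x y hJ => ⟨hJ.1, fun u => funext fun i => enc.injective ?_⟩
  funext j
  simpa using congrFun (hJ.2 u) (finProdFinEquiv (j, i))

variable {F E : Type*} [Nonempty F] [Finite F] {s : ℕ}

/-- Direct delivery of the items `e : E` from `src e` to `dst e`, each link having `k` slots. -/
theorem deliver (hs : Nat.card F ≤ 2 ^ (b * s)) (h : Reach n b f T J) (k : ℕ) (src dst : E → Fin n)
    (slot : E → Fin k) (hinj : Function.Injective fun e => (src e, dst e, slot e)) (val : X → E → F)
    (hval : ∀ e x y, J (src e) x y → val x e = val y e) :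
    Reach n b f (T + s * k) (fun v x y => J v x y ∧ ∀ e, dst e = v → val x e = val y e) := by
  classical
  have a : F := Classical.arbitrary F
  have := h.sendSymbols hs k (fun x u v i =>
    if h : ∃ e, (src e, dst e, slot e) = (u, v, i) then val x h.choose else a) (by
      intro u x y hJ
      funext v i
      split_ifs with he
      · have h₁ : src he.choose = u := (Prod.ext_iff.1 he.choose_spec).1
        exact hval _ _ _ (h₁.symm ▸ hJ)
      · rfl)
  refine this.mono fun v x y hJ => ⟨hJ.1, fun e he => ?_⟩
  have h₁ := congrFun (hJ.2 (src e)) (slot e)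
  have h₂ : ∃ e', (src e', dst e', slot e') = (src e, v, slot e) := ⟨e, by rw [he]⟩
  rw [dif_pos h₂, dif_pos h₂] at h₁
  have h₃ : h₂.choose = e := hinj (h₂.choose_spec.trans (by simp only [he]))
  rwa [h₃] at h₁

end Reach

/-! ### Balanced two-hop routing -/

/-- Greedy colouring of the edges of a bipartite multigraph. -/
theorem exists_edge_colouring {E V W : Type*} [Finite E] (src : E → V) (dst : E → W) (D : ℕ)
    (hsrc : ∀ v, Nat.card {e // src e = v} ≤ D) (hdst : ∀ v, Nat.card {e // dst e = v} ≤ D) :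
    ∃ col : E → Fin (2 * D), (Function.Injective fun e => (src e, col e)) ∧
      Function.Injective fun e => (dst e, col e) := by
  classical
  have := Fintype.ofFinite E
  suffices H : ∀ S : Finset E, ∃ col : E → ℕ, (∀ e ∈ S, col e < 2 * D) ∧
      ∀ e ∈ S, ∀ e' ∈ S, (src e = src e' ∨ dst e = dst e') → col e = col e' → e = e' by
    obtain ⟨col, h₁, h₂⟩ := H Finset.univ
    refine ⟨fun e => ⟨col e, h₁ e (Finset.mem_univ e)⟩, fun e e' h => ?_, fun e e' h => ?_⟩ <;>
    · simp only [Prod.mk.injEq, Fin.mk.injEq] at h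
      exact h₂ e (Finset.mem_univ _) e' (Finset.mem_univ _) (by tauto) h.2
  intro S
  induction S using Finset.induction_on with
  | empty => exact ⟨fun _ => 0, by simp, by simp⟩
  | insert a S ha ih =>
    obtain ⟨col, h₁, h₂⟩ := ih
    -- The other edges sharing an endpoint with `a` number at most 2(D - 1), which leaves a free
    -- colour among 2D.
    let N := (Finset.univ.filter fun e => src e = src a).erase a ∪
      (Finset.univ.filter fun e => dst e = dst a).erase a
    have hpos : 0 < D := (Nat.card_pos_iff.2 ⟨⟨⟨a, rfl⟩⟩, inferInstance⟩).trans_le (hsrc (src a))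
    have hN : N.card < 2 * D := by
      have e₁ := hsrc (src a)
      have e₂ := hdst (dst a)
      rw [Nat.card_eq_fintype_card, Fintype.card_subtype] at e₁ e₂
      have : N.card ≤ _ := Finset.card_union_le _ _
      rw [Finset.card_erase_of_mem (by simp), Finset.card_erase_of_mem (by simp)] at this
      omega
    obtain ⟨c, hc, hcN⟩ : ∃ c ∈ Finset.range (2 * D), c ∉ N.image col := by
      apply Finset.exists_mem_notMem_of_card_lt_card
      rw [Finset.card_range]
      exact Finset.card_image_le.trans_lt hN
    have key : ∀ e ∈ S, (src e = src a ∨ dst e = dst a) → col e ≠ c := by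
      intro e he h hce
      refine hcN (Finset.mem_image.2 ⟨e, ?_, hce⟩)
      have : e ≠ a := fun h => ha (h ▸ he)
      simp only [N, Finset.mem_union, Finset.mem_erase, Finset.mem_filter, Finset.mem_univ,
        true_and]
      tauto
    have upd : ∀ e ∈ S, Function.update col a c e = col e := fun e he =>
      Function.update_of_ne (ne_of_mem_of_not_mem he ha) _ _
    refine ⟨Function.update col a c, ?_, ?_⟩
    · intro e he
      rcases Finset.mem_insert.1 he with rfl | he
      · simpa using hc
      · rw [upd e he]; exact h₁ e he
    · intro e he e' he' hor hcol
      rcases Finset.mem_insert.1 he with h | he <;>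
        rcases Finset.mem_insert.1 he' with h' | he'
      · rw [h, h']
      · rw [h, upd e' he', Function.update_self] at hcol
        exact absurd hcol.symm (key e' he' (h ▸ hor.imp Eq.symm Eq.symm))
      · rw [h', upd e he, Function.update_self] at hcol
        exact absurd hcol (key e he (h' ▸ hor))
      · rw [upd e he, upd e' he'] at hcol
        exact h₂ e he e' he' hor hcol

namespace Reach

variable {n b : ℕ} {X In : Type*} {f : X → Fin n → In} {T : ℕ} {J : Fin n → X → X → Prop}
variable {F : Type*} [Nonempty F] [Finite F] {s : ℕ}

/-- Routing along a pattern known in advance: every node sends and receives at most `m * n` items.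
An item with colour `c` travels through node `c % n`. -/
theorem route {E : Type*} [Finite E] (hs : Nat.card F ≤ 2 ^ (b * s)) (h : Reach n b f T J) (m : ℕ)
    (src dst : E → Fin n) (hsrc : ∀ v, Nat.card {e // src e = v} ≤ m * n)
    (hdst : ∀ v, Nat.card {e // dst e = v} ≤ m * n) (val : X → E → F)
    (hval : ∀ e x y, J (src e) x y → val x e = val y e) :
    Reach n b f (T + 4 * m * s) (fun v x y => J v x y ∧ ∀ e, dst e = v → val x e = val y e) := by
  obtain ⟨col, h₁, h₂⟩ := exists_edge_colouring src dst (m * n) hsrc hdst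
  -- A colour encodes an intermediate node and one of 2m slots. Distinct colours at a common source
  -- make the first hop collision-free, and at a common destination the second.
  let φ : Fin (2 * (m * n)) ≃ Fin (2 * m) × Fin n :=
    (finCongr (by ring)).trans finProdFinEquiv.symm
  let mid : E → Fin n := fun e => (φ (col e)).2
  let slot : E → Fin (2 * m) := fun e => (φ (col e)).1
  have hφ : ∀ e e', mid e = mid e' → slot e = slot e' → col e = col e' := fun e e' h h' =>
    φ.injective (Prod.ext h' h)
  have r₁ := h.deliver hs (2 * m) src mid slot (fun e e' he => by
    simp only [Prod.mk.injEq] at he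
    exact h₁ (Prod.ext he.1 (hφ e e' he.2.1 he.2.2))) val hval
  have r₂ := r₁.deliver hs (2 * m) mid dst slot (fun e e' he => by
    simp only [Prod.mk.injEq] at he
    exact h₂ (Prod.ext he.2.1 (hφ e e' he.1 he.2.2))) val (fun e x y hJ => hJ.2 e rfl)
  rw [show T + s * (2 * m) + s * (2 * m) = T + 4 * m * s by ring] at r₂
  exact r₂.mono fun v x y hJ => ⟨hJ.1.1, hJ.2⟩

/-- Routing of items indexed by a product, when the source depends on the first factor only and the
destination on the second. -/
theorem routeProd {α γ : Type*} [Finite α] [Finite γ] (hs : Nat.card F ≤ 2 ^ (b * s))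
    (h : Reach n b f T J) (m : ℕ)
    (src : α → Fin n) (dst : γ → Fin n) (hsrc : ∀ v, Nat.card {a // src a = v} * Nat.card γ ≤ m * n)
    (hdst : ∀ v, Nat.card α * Nat.card {c // dst c = v} ≤ m * n) (val : X → α → γ → F)
    (hval : ∀ a x y, J (src a) x y → val x a = val y a) :
    Reach n b f (T + 4 * m * s)
      (fun v x y => J v x y ∧ ∀ a c, dst c = v → val x a c = val y a c) := by
  have := h.route hs m (fun e : α × γ => src e.1) (fun e => dst e.2)
    (fun v => by
      refine le_trans ?_ (hsrc v)
      rw [← Nat.card_prod]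
      exact Nat.card_le_card_of_injective
        (fun e : {e : α × γ // src e.1 = v} => ((⟨e.1.1, e.2⟩, e.1.2) : {a // src a = v} × γ))
        (fun e e' he => by
          simp only [Prod.mk.injEq, Subtype.mk.injEq] at he
          exact Subtype.ext (Prod.ext he.1 he.2)))
    (fun v => by
      refine le_trans ?_ (hdst v)
      rw [← Nat.card_prod]
      exact Nat.card_le_card_of_injective
        (fun e : {e : α × γ // dst e.2 = v} => ((e.1.1, ⟨e.1.2, e.2⟩) : α × {c // dst c = v}))
        (fun e e' he => by
          simp only [Prod.mk.injEq, Subtype.mk.injEq] at he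
          exact Subtype.ext (Prod.ext he.1 he.2)))
    (fun x e => val x e.1 e.2) (fun e x y hJ => by simp only [hval e.1 x y hJ])
  exact this.mono fun v x y hJ => ⟨hJ.1, fun a c hc => hJ.2 (a, c) hc⟩

end Reach

/-- Even distribution of a finite set among `n` nodes. -/
theorem exists_balanced_map (α : Type*) [Finite α] {n : ℕ} (hn : 1 ≤ n) :
    ∃ π : α → Fin n, ∀ v, Nat.card {a // π a = v} ≤ Nat.card α / n + 1 := by
  let e := Finite.equivFin α
  refine ⟨fun a => ⟨(e a : ℕ) % n, Nat.mod_lt _ hn⟩, fun v => ?_⟩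
  rw [← Nat.card_fin (Nat.card α / n + 1)]
  refine Nat.card_le_card_of_injective (fun a => ⟨(e a.1 : ℕ) / n,
    Nat.lt_succ_of_le (Nat.div_le_div_right (e a.1).2.le)⟩) ?_
  rintro ⟨a, ha⟩ ⟨a', ha'⟩ h
  simp only [Fin.mk.injEq] at h
  have h₂ : (e a : ℕ) % n = (e a' : ℕ) % n := by
    have := ha.trans ha'.symm
    simpa using this
  have : (e a : ℕ) = e a' := by
    rw [← Nat.div_add_mod (e a : ℕ) n, ← Nat.div_add_mod (e a' : ℕ) n, h, h₂]
  simpa using e.injective (Fin.ext this)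

/-! ### Characteristic polynomial from traces, inverse from characteristic polynomial -/

open Polynomial in
/-- The derivative of a determinant, column by column. -/
theorem Matrix.derivative_det {m R : Type*} [Fintype m] [DecidableEq m] [CommRing R]
    (M : Matrix m m R[X]) :
    derivative M.det = ∑ j, (M.updateCol j fun i => derivative (M i j)).det := by
  simp only [det_apply, derivative_sum, derivative_smul, derivative_prod_finset]
  rw [Finset.sum_comm]
  refine Finset.sum_congr rfl fun σ _ => ?_
  rw [← Finset.smul_sum]
  congr 1
  refine Finset.sum_congr rfl fun j _ => ?_
  rw [← Finset.mul_prod_erase _ _ (Finset.mem_univ j), updateCol_self, mul_comm]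
  congr 1
  refine Finset.prod_congr rfl fun i hi => ?_
  rw [updateCol_ne (Finset.ne_of_mem_erase hi)]

open Polynomial in
-- Differentiating column `j` of X - A leaves the `j`-th unit vector, so each term is a diagonal
-- cofactor.
theorem Matrix.derivative_charpoly {m R : Type*} [Fintype m] [DecidableEq m] [CommRing R]
    (A : Matrix m m R) : derivative A.charpoly = (adjugate (charmatrix A)).trace := by
  rw [charpoly, derivative_det, ← trace_transpose, adjugate_transpose, trace]
  refine Finset.sum_congr rfl fun j _ => ?_
  rw [diag_apply, adjugate_apply, updateRow_transpose, det_transpose]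
  congr 2
  funext i
  by_cases hij : i = j
  · subst hij
    simp
  · simp [hij]

open Polynomial in
/-- The Newton identities for the characteristic polynomial and the traces of powers. -/
theorem Matrix.newton_charpoly {n : ℕ} {R : Type*} [Field R] (A : Matrix (Fin n) (Fin n) R)
    (k : ℕ) : ((k : R) - n) * A.charpoly.coeff k =
      ∑ i ∈ Finset.range n, A.charpoly.coeff (k + 1 + i) * (A ^ (i + 1)).trace := by
  set c := A.charpoly.coeff with hc
  -- Comparing coefficients in N(X - A) = charpoly · 1 gives a recursion for those of `N`. Unrolled,
  -- it expresses tr(N_j A) by traces of powers, while tr N_j is a coefficient of the derivative of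
  -- the characteristic polynomial.
  set N : (Matrix (Fin n) (Fin n) R)[X] := matPolyEquiv (adjugate (charmatrix A)) with hN
  have hmul : N * (X - C A) = matPolyEquiv (A.charpoly • 1) := by
    rw [← matPolyEquiv_charmatrix, ← map_mul, adjugate_mul, charpoly]
  have hdeg : ∀ j, n < j → c j = 0 := fun j hj =>
    coeff_eq_zero_of_natDegree_lt (by rw [charpoly_natDegree_eq_dim]; simpa using hj)
  have hcoeff : ∀ j, (matPolyEquiv (A.charpoly • (1 : Matrix (Fin n) (Fin n) R[X]))).coeff j = c j • 1 := by
    intro j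
    ext a b
    rw [matPolyEquiv_coeff_apply]
    simp [Matrix.one_apply, hc, apply_ite (fun p : R[X] => p.coeff j)]
  have hsucc : ∀ j, N.coeff j = N.coeff (j + 1) * A + c (j + 1) • 1 := by
    intro j
    rw [← hcoeff, ← hmul, mul_sub, coeff_sub, coeff_mul_X, coeff_mul_C]
    abel
  have hzero : -(N.coeff 0 * A) = c 0 • (1 : Matrix (Fin n) (Fin n) R) := by
    rw [← hcoeff, ← hmul, mul_sub, coeff_sub, coeff_mul_X_zero, coeff_mul_C, zero_sub]
  have hexp : ∀ l j, N.coeff j * A = ∑ i ∈ Finset.range l, c (j + 1 + i) • A ^ (i + 1) +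
      N.coeff (j + l) * A ^ (l + 1) := by
    intro l
    induction l with
    | zero => simp
    | succ l ih =>
      intro j
      rw [ih, Finset.sum_range_succ, hsucc (j + l), add_mul, mul_assoc, ← pow_succ' A,
        smul_mul_assoc, one_mul, show j + 1 + l = j + l + 1 by ring, ← add_assoc j l 1]
      abel
  have htr : ∀ j, (N.coeff j * A).trace =
      ∑ i ∈ Finset.range n, c (j + 1 + i) * (A ^ (i + 1)).trace := by
    intro j
    rw [hexp (n + (N.natDegree + 1)) j, coeff_eq_zero_of_natDegree_lt (by omega), zero_mul,
      add_zero, trace_sum]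
    simp only [trace_smul, smul_eq_mul]
    refine (Finset.sum_subset (Finset.range_mono (by omega)) fun i _ hi => ?_).symm
    rw [Finset.mem_range, not_lt] at hi
    rw [hdeg _ (by omega), zero_mul]
  have hder : ∀ j, (N.coeff j).trace = c (j + 1) * (j + 1) := by
    intro j
    rw [hc, ← coeff_derivative, derivative_charpoly, trace, trace, finsetSum_coeff]
    simp [hN, matPolyEquiv_coeff_apply]
  rcases k with _ | k
  · rw [← htr, ← neg_neg (N.coeff 0 * A), hzero]
    simp [mul_comm]
  · rw [← htr, eq_comm]
    have := congrArg trace (hsucc k)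
    rw [hder, trace_add, trace_smul, trace_one] at this
    simp only [Fintype.card_fin, smul_eq_mul] at this
    push_cast
    linear_combination -this

/-- In characteristic larger than `n`, the traces of the first `n` powers determine the
characteristic polynomial. -/
theorem Matrix.charpoly_eq_of_trace_pow_eq {n : ℕ} {R : Type*} [Field R] (hchar : n < ringChar R)
    (A B : Matrix (Fin n) (Fin n) R)
    (h : ∀ i < n, (A ^ (i + 1)).trace = (B ^ (i + 1)).trace) : A.charpoly = B.charpoly := by
  have hdeg : ∀ (A : Matrix (Fin n) (Fin n) R) (j), n < j → A.charpoly.coeff j = 0 := fun A j hj =>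
    Polynomial.coeff_eq_zero_of_natDegree_lt (by rw [charpoly_natDegree_eq_dim]; simpa using hj)
  have hlead : ∀ A : Matrix (Fin n) (Fin n) R, A.charpoly.coeff n = 1 := fun A => by
    simpa [Polynomial.Monic.def, Polynomial.leadingCoeff, charpoly_natDegree_eq_dim]
      using A.charpoly_monic
  -- Descent from the leading coefficient: Newton's identity gives coefficient `k` from higher ones,
  -- since 0 < n - k < char.
  suffices H : ∀ l k, n ≤ k + l → A.charpoly.coeff k = B.charpoly.coeff k from
    Polynomial.ext fun k => H n k (by omega)
  intro l
  induction l with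
  | zero =>
    intro k hk
    rcases (show n ≤ k from hk).eq_or_lt with rfl | hk
    · rw [hlead, hlead]
    · rw [hdeg _ _ hk, hdeg _ _ hk]
  | succ l ih =>
    intro k hk
    by_cases hkn : n ≤ k
    · exact ih k (by omega)
    have hne : ((k : R) - n) ≠ 0 := by
      intro h0
      have : ((n - k : ℕ) : R) = 0 := by
        rw [Nat.cast_sub (by omega)]
        linear_combination -h0
      rw [ringChar.spec] at this
      exact absurd (Nat.le_of_dvd (by omega) this) (by omega)
    apply mul_left_cancel₀ hne
    rw [newton_charpoly, newton_charpoly]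
    refine Finset.sum_congr rfl fun i hi => ?_
    rw [ih (k + 1 + i) (by omega), h i (Finset.mem_range.1 hi)]

/-- A polynomial expression in `A`, depending on `charpoly A` only, for the inverse. -/
noncomputable def invCoeff {R : Type*} [Field R] (p : Polynomial R) (k : ℕ) : R :=
  -(p.coeff 0)⁻¹ * p.coeff (k + 1)

/-- Cayley–Hamilton divided by the constant term. Coefficients beyond degree n vanish, so the range
may be enlarged to a full `h * h` grid. -/
theorem Matrix.inv_eq_sum_invCoeff {n : ℕ} {R : Type*} [Field R] (A : Matrix (Fin n) (Fin n) R)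
    (hA : IsUnit A) (N : ℕ) (hN : n ≤ N) :
    A⁻¹ = ∑ k ∈ Finset.range N, invCoeff A.charpoly k • A ^ k := by
  have hdet : A.det ≠ 0 := ((isUnit_iff_isUnit_det A).1 hA).ne_zero
  have h0 : A.charpoly.coeff 0 ≠ 0 := by
    intro h
    rw [det_eq_sign_charpoly_coeff, h, mul_zero] at hdet
    exact hdet rfl
  have hCH := aeval_self_charpoly A
  rw [Polynomial.aeval_eq_sum_range' (n := N + 1) (by
    rw [charpoly_natDegree_eq_dim, Fintype.card_fin]; omega), Finset.sum_range_succ'] at hCH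
  apply inv_eq_left_inv
  rw [Finset.sum_mul]
  simp only [invCoeff, smul_mul_assoc, ← pow_succ, mul_smul, ← Finset.smul_sum]
  rw [eq_neg_of_add_eq_zero_left hCH]
  simp [smul_smul, h0]

/-! ### Bilinear algorithms on padded block matrices -/

section MatMulAlgorithm

variable {F : Type*} [Field F]

/-- Algorithms for the product of matrices apply to block matrices. -/
theorem block_product {d t : ℕ} {α β γ : Fin d → Fin d → Fin t → F}
    (h : ∀ (A B : Matrix (Fin d) (Fin d) F) (i j : Fin d),
      (A * B) i j = ∑ μ, γ i j μ *
        (∑ i', ∑ j', α i' j' μ * A i' j') * (∑ i', ∑ j', β i' j' μ * B j' i'))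
    {q : Type*} [Fintype q] (A B : Fin d → q → Fin d → q → F) (i j : Fin d) (a c : q) :
    ∑ μ, γ i j μ * ∑ b, (∑ i', ∑ j', α i' j' μ * A i' a j' b) *
        (∑ i', ∑ j', β i' j' μ * B j' b i' c) =
      ∑ l, ∑ b, A i a l b * B l b j c := by
  have e : ∀ (μ : Fin t) (g : q → F), γ i j μ * ∑ b, g b = ∑ b, γ i j μ * g b :=
    fun μ g => Finset.mul_sum _ _ _
  simp only [e]
  rw [Finset.sum_comm, Finset.sum_comm (s := (Finset.univ : Finset (Fin d)))]
  -- With the positions `a`, `b`, `c` inside the blocks fixed, only d × d scalar matrices remain, so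
  -- the identity over the field is enough.
  refine Finset.sum_congr rfl fun b _ => ?_
  refine Eq.trans ?_ (h (Matrix.of fun i' j' => A i' a j' b)
    (Matrix.of fun j' i' => B j' b i' c) i j).symm
  simp only [mul_assoc, Matrix.of_apply]

/-- The rank of an algorithm for matrix multiplication is at least quadratic. -/
theorem HasMatMulAlgorithm.sq_le {d t : ℕ} (h : HasMatMulAlgorithm F d d t) : d ^ 2 ≤ t := by
  obtain ⟨α, β, γ, h⟩ := h
  -- Multiplying by B = 1 recovers A from its `t` linear forms, so `L` is injective.
  let L : Matrix (Fin d) (Fin d) F →ₗ[F] (Fin t → F) :=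
    { toFun := fun A μ => ∑ i', ∑ j', α i' j' μ * A i' j'
      map_add' := fun A B => by
        funext μ; simp [mul_add, Finset.sum_add_distrib]
      map_smul' := fun c A => by
        funext μ; simp [Finset.mul_sum, mul_left_comm] }
  have hL : Function.Injective L := by
    intro A B hAB
    ext i j
    have hA := h A 1 i j
    have hB := h B 1 i j
    have e : ∀ μ, (∑ i', ∑ j', α i' j' μ * A i' j') = ∑ i', ∑ j', α i' j' μ * B i' j' :=
      fun μ => congrFun hAB μ
    rw [mul_one] at hA hB
    rw [hA, hB]
    simp only [e]
  have := LinearMap.finrank_le_finrank_of_injective hL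
  simpa [Module.finrank_matrix, sq] using this

end MatMulAlgorithm

theorem rowCol_eq_iff {n : ℕ} {F : Type*} {A B : Matrix (Fin n) (Fin n) F} {v : Fin n} :
    rowCol A v = rowCol B v ↔ (∀ j, A v j = B v j) ∧ ∀ i, A i v = B i v := by
  simp [rowCol, Prod.ext_iff, funext_iff]

section Padding

variable {ι κ F : Type*} [Field F] (ε : ι → κ)

/-- Extension of a matrix by zero along an embedding of the index set. -/
noncomputable def padMatrix (M : Matrix ι ι F) (p r : κ) : F :=
  Function.extend ε (fun i => Function.extend ε (M i) 0 r) 0 p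

variable {ε}

theorem padMatrix_apply (hε : Function.Injective ε) (M : Matrix ι ι F) (i j : ι) :
    padMatrix ε M (ε i) (ε j) = M i j := by
  rw [padMatrix, hε.extend_apply, hε.extend_apply]

theorem padMatrix_of_left (M : Matrix ι ι F) {p : κ} (hp : p ∉ Set.range ε) (r : κ) :
    padMatrix ε M p r = 0 := by
  rw [padMatrix, Function.extend_apply' _ _ _ hp, Pi.zero_apply]

theorem padMatrix_of_right (hε : Function.Injective ε) (M : Matrix ι ι F) (p : κ) {r : κ}
    (hr : r ∉ Set.range ε) : padMatrix ε M p r = 0 := by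
  by_cases hp : p ∈ Set.range ε
  · obtain ⟨i, rfl⟩ := hp
    rw [padMatrix, hε.extend_apply, Function.extend_apply' _ _ _ hr, Pi.zero_apply]
  · exact padMatrix_of_left M hp r

/-- A padded entry depends on at most one original entry, so a node holding the latter knows the
former. -/
theorem padMatrix_congr (hε : Function.Injective ε) {M N : Matrix ι ι F} {p r : κ}
    (h : ∀ i j, ε i = p → ε j = r → M i j = N i j) : padMatrix ε M p r = padMatrix ε N p r := by
  by_cases hp : p ∈ Set.range ε
  · by_cases hr : r ∈ Set.range ε
    · obtain ⟨i, rfl⟩ := hp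
      obtain ⟨j, rfl⟩ := hr
      rw [padMatrix_apply hε, padMatrix_apply hε, h i j rfl rfl]
    · rw [padMatrix_of_right hε _ _ hr, padMatrix_of_right hε _ _ hr]
  · rw [padMatrix_of_left _ hp, padMatrix_of_left _ hp]

theorem sum_padMatrix_mul [Fintype ι] [Fintype κ] (hε : Function.Injective ε) (A B : Matrix ι ι F)
    (i j : ι) : ∑ p, padMatrix ε A (ε i) p * padMatrix ε B p (ε j) = (A * B) i j := by
  rw [Matrix.mul_apply]
  refine (Fintype.sum_of_injective ε hε _ _ (fun p hp => ?_) fun l => ?_).symm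
  · rw [padMatrix_of_left B hp, mul_zero]
  · rw [padMatrix_apply hε, padMatrix_apply hε]

end Padding

/-! ### Simultaneous matrix products -/

namespace Reach

variable {n b : ℕ} {X In : Type*} {f : X → Fin n → In} {T : ℕ} {J : Fin n → X → X → Prop}
variable {F : Type*} [Field F] [Finite F] {s : ℕ}

/-- Simultaneous computation of `k` products of matrices, by means of an algebraic algorithm of
rank `t` for `d × d` matrices. Products of blocks are indexed by `Fin k × Fin t`, positions in a
block by `Fin q × Fin q`; both are distributed evenly among the nodes. -/
theorem matMul (hs : Nat.card F ≤ 2 ^ (b * s)) (hn : 1 ≤ n) {d t k R : ℕ} (hd : 1 ≤ d)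
    (hdn : d * d ≤ n) (hR : k * t ≤ R * n) (halg : HasMatMulAlgorithm F d d t)
    (h : Reach n b f T J) (A B : X → Fin k → Matrix (Fin n) (Fin n) F)
    (hA : ∀ v x y, J v x y → ∀ c j, A x c v j = A y c v j)
    (hB : ∀ v x y, J v x y → ∀ c j, B x c v j = B y c v j) :
    Reach n b f (T + (80 * k + 12 * ((R + 1) * ((n / d + 1) * (n / d + 1) / n + 1))) * s)
      (fun v x y => J v x y ∧ ∀ c, rowCol (A x c * B x c) v = rowCol (A y c * B y c) v) := by
  obtain ⟨α, β, γ, halg⟩ := halg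
  set q := n / d + 1 with hq
  set W := q * q / n + 1 with hW
  have hqd : n ≤ d * q := by
    have := Nat.lt_mul_div_succ n (show 0 < d by omega)
    rw [hq]; exact this.le
  have hqd' : q * d ≤ 2 * n := by
    have := Nat.div_mul_le_self n d
    have : d ≤ n := le_trans (Nat.le_mul_self d) hdn
    rw [hq, add_mul]; omega
  have hWn : q * q ≤ W * n := by
    have := Nat.lt_mul_div_succ (q * q) (show 0 < n by omega)
    exact this.le.trans_eq (mul_comm _ _)
  have hWd : W * (d * d) ≤ 5 * n := by
    have h₁ : q * q / n * (d * d) * n ≤ 4 * n * n := by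
      calc q * q / n * (d * d) * n = (q * q / n * n) * (d * d) := by ring
        _ ≤ (q * q) * (d * d) := Nat.mul_le_mul_right _ (Nat.div_mul_le_self _ _)
        _ = (q * d) * (q * d) := by ring
        _ ≤ (2 * n) * (2 * n) := Nat.mul_le_mul hqd' hqd'
        _ = 4 * n * n := by ring
    have h₂ := Nat.le_of_mul_le_mul_right h₁ (by omega)
    rw [hW, add_mul]; omega
  obtain ⟨⟨ε, hε⟩⟩ : Nonempty (Fin n ↪ Fin d × Fin q) :=
    Function.Embedding.nonempty_of_card_le (by simpa using hqd)
  obtain ⟨π, hπ⟩ := exists_balanced_map (Fin q × Fin q) hn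
  obtain ⟨ν, hν⟩ := exists_balanced_map (Fin k × Fin t) hn
  simp only [Nat.card_prod, Nat.card_eq_fintype_card (α := Fin _), Fintype.card_fin] at hπ hν
  have hν' : ∀ v, Nat.card {z // ν z = v} ≤ R + 1 := fun v =>
    (hν v).trans (Nat.succ_le_succ (Nat.div_le_of_le_mul (by rwa [mul_comm n])))
  -- Entries at the same position in different blocks meet at one node, which can therefore evaluate
  -- the linear forms at that position.
  let pos : Fin k × Fin n × Fin n → Fin n := fun e => π ((ε e.2.1).2, (ε e.2.2).2)
  have hpos : ∀ v, Nat.card {e // pos e = v} ≤ 5 * k * n := by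
    intro v
    have := Nat.card_le_card_of_injective
      (fun e : {e // pos e = v} => ((e.1.1, ⟨((ε e.1.2.1).2, (ε e.1.2.2).2), e.2⟩,
        (ε e.1.2.1).1, (ε e.1.2.2).1) : Fin k × {p // π p = v} × Fin d × Fin d)) (by
        rintro ⟨⟨c, i, j⟩, he⟩ ⟨⟨c', i', j'⟩, he'⟩ h
        simp only [Prod.mk.injEq, Subtype.mk.injEq] at h ⊢
        exact ⟨h.1, hε (Prod.ext h.2.2.1 h.2.1.1), hε (Prod.ext h.2.2.2 h.2.1.2)⟩)
    simp only [Nat.card_prod, Nat.card_eq_fintype_card (α := Fin _), Fintype.card_fin] at this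
    calc _ ≤ _ := this
      _ ≤ k * (W * (d * d)) := Nat.mul_le_mul_left _ (Nat.mul_le_mul_right _ (hπ v))
      _ ≤ k * (5 * n) := Nat.mul_le_mul_left _ hWd
      _ = 5 * k * n := by ring
  have hkn : k * n ≤ 5 * k * n := by nlinarith [Nat.zero_le (k * n)]
  have hrow : ∀ v, Nat.card {e : Fin k × Fin n × Fin n // e.2.1 = v} ≤ 5 * k * n := by
    intro v
    have := Nat.card_le_card_of_injective
      (fun e : {e : Fin k × Fin n × Fin n // e.2.1 = v} => (e.1.1, e.1.2.2)) (by
        rintro ⟨⟨c, i, j⟩, he⟩ ⟨⟨c', i', j'⟩, he'⟩ h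
        simp only [Prod.mk.injEq, Subtype.mk.injEq] at h he he' ⊢
        exact ⟨h.1, he.trans he'.symm, h.2⟩)
    simp only [Nat.card_prod, Nat.card_eq_fintype_card (α := Fin _), Fintype.card_fin] at this
    exact this.trans hkn
  have hcol : ∀ v, Nat.card {e : Fin k × Fin n × Fin n // e.2.2 = v} ≤ 5 * k * n := by
    intro v
    have := Nat.card_le_card_of_injective
      (fun e : {e : Fin k × Fin n × Fin n // e.2.2 = v} => (e.1.1, e.1.2.1)) (by
        rintro ⟨⟨c, i, j⟩, he⟩ ⟨⟨c', i', j'⟩, he'⟩ h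
        simp only [Prod.mk.injEq, Subtype.mk.injEq] at h he he' ⊢
        exact ⟨h.1, h.2, he.trans he'.symm⟩)
    simp only [Nat.card_prod, Nat.card_eq_fintype_card (α := Fin _), Fintype.card_fin] at this
    exact this.trans hkn
  have hload : ∀ v w, Nat.card {p // π p = v} * Nat.card (Fin k × Fin t) ≤ (R + 1) * W * n ∧
      Nat.card (Fin q × Fin q) * Nat.card {z // ν z = w} ≤ (R + 1) * W * n := by
    intro v w
    simp only [Nat.card_prod, Nat.card_eq_fintype_card (α := Fin _), Fintype.card_fin]
    constructor
    · calc _ ≤ W * ((R + 1) * n) := Nat.mul_le_mul (hπ v) (hR.trans (by gcongr; omega))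
        _ = _ := by ring
    · calc _ ≤ (W * n) * (R + 1) := Nat.mul_le_mul hWn (hν' w)
        _ = _ := by ring
  -- `S` and `S'` are the factors of block product `z`, entrywise, and `U` is the product. Node `ν
  -- z` collects both factors, multiplies locally and returns the entries to the owners of the
  -- positions.
  let S : X → Fin q × Fin q → Fin k × Fin t → F := fun x p z =>
    ∑ i, ∑ j, α i j z.2 * padMatrix ε (A x z.1) (i, p.1) (j, p.2)
  let S' : X → Fin q × Fin q → Fin k × Fin t → F := fun x p z =>
    ∑ i, ∑ j, β i j z.2 * padMatrix ε (B x z.1) (j, p.1) (i, p.2)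
  let U : X → Fin k × Fin t → Fin q × Fin q → F := fun x z p =>
    ∑ l, S x (p.1, l) z * S' x (l, p.2) z
  have hU : ∀ x c i j, (A x c * B x c) i j =
      ∑ μ, γ (ε i).1 (ε j).1 μ * U x (c, μ) ((ε i).2, (ε j).2) := by
    intro x c i j
    rw [← sum_padMatrix_mul hε, Fintype.sum_prod_type]
    exact (block_product halg (fun i a j b => padMatrix ε (A x c) (i, a) (j, b))
      (fun i a j b => padMatrix ε (B x c) (i, a) (j, b)) _ _ _ _).symm
  have r₁ := h.route hs (5 * k) (fun e : Fin k × Fin n × Fin n => e.2.1) pos hrow hpos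
    (fun x e => A x e.1 e.2.1 e.2.2) (fun e x y hJ => hA _ _ _ hJ _ _)
  have r₂ := r₁.route hs (5 * k) (fun e : Fin k × Fin n × Fin n => e.2.1) pos hrow hpos
    (fun x e => B x e.1 e.2.1 e.2.2) (fun e x y hJ => hB _ _ _ hJ.1 _ _)
  have r₃ := r₂.routeProd hs ((R + 1) * W) π ν (fun v => (hload v v).1) (fun v => (hload v v).2) S
    (by
      rintro ⟨a, e⟩ x y hJ
      funext z
      refine Finset.sum_congr rfl fun i _ => Finset.sum_congr rfl fun j _ => ?_
      congr 1
      refine padMatrix_congr hε fun i' j' hi hj => hJ.1.2 (z.1, i', j') ?_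
      simp only [pos, hi, hj])
  have r₄ := r₃.routeProd hs ((R + 1) * W) π ν (fun v => (hload v v).1) (fun v => (hload v v).2) S'
    (by
      rintro ⟨a, e⟩ x y hJ
      funext z
      refine Finset.sum_congr rfl fun i _ => Finset.sum_congr rfl fun j _ => ?_
      congr 1
      refine padMatrix_congr hε fun i' j' hi hj => hJ.1.2 (z.1, i', j') ?_
      simp only [pos, hi, hj])
  have r₅ := r₄.routeProd hs ((R + 1) * W) ν π (fun v => (mul_comm _ _).trans_le (hload v v).2)
    (fun v => (mul_comm _ _).trans_le (hload v v).1) U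
    (by
      intro z x y hJ
      funext p
      refine Finset.sum_congr rfl fun l _ => ?_
      rw [hJ.1.2 _ _ rfl, hJ.2 _ _ rfl])
  have hval : ∀ (e : Fin k × Fin n × Fin n) (x y : X),
      (∀ z p, π p = pos e → U x z p = U y z p) →
      (A x e.1 * B x e.1) e.2.1 e.2.2 = (A y e.1 * B y e.1) e.2.1 e.2.2 := by
    intro e x y hJ
    rw [hU, hU]
    refine Finset.sum_congr rfl fun μ _ => ?_
    rw [hJ _ _ rfl]
  have r₆ := r₅.route hs (5 * k) pos (fun e : Fin k × Fin n × Fin n => e.2.1) hpos hrow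
    (fun x e => (A x e.1 * B x e.1) e.2.1 e.2.2) (fun e x y hJ => hval e x y hJ.2)
  have r₇ := r₆.route hs (5 * k) pos (fun e : Fin k × Fin n × Fin n => e.2.2) hpos hcol
    (fun x e => (A x e.1 * B x e.1) e.2.1 e.2.2) (fun e x y hJ => hval e x y hJ.1.2)
  refine (r₇.le (le_of_eq (by ring))).mono fun v x y hJ =>
    ⟨hJ.1.1.1.1.1.1.1, fun c => rowCol_eq_iff.2
      ⟨fun j => hJ.1.2 (c, v, j) rfl, fun i => hJ.2 (c, i, v) rfl⟩⟩

end Reach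

/-! ### Powers, traces, determinant and inverse -/

/-- Given the rows and columns of `k` pairs of matrices, the nodes can compute the products in `c`
rounds. -/
def CanMultiply {n : ℕ} (b : ℕ) {X In : Type*} (f : X → Fin n → In) (F : Type*) [Field F]
    (k c : ℕ) : Prop :=
  ∀ (T : ℕ) (J : Fin n → X → X → Prop) (A B : X → Fin k → Matrix (Fin n) (Fin n) F),
    Reach n b f T J →
    (∀ v x y, J v x y → ∀ i, rowCol (A x i) v = rowCol (A y i) v ∧
      rowCol (B x i) v = rowCol (B y i) v) →
    Reach n b f (T + c)
      (fun v x y => J v x y ∧ ∀ i, rowCol (A x i * B x i) v = rowCol (A y i * B y i) v)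

section Powers

variable {n b : ℕ} {X In : Type*} {f : X → Fin n → In} {T : ℕ} {J : Fin n → X → X → Prop}
variable {F : Type*} [Field F]

/-- Powers of a matrix by repeated doubling. -/
theorem Reach.powers (a : ℕ) (cost : ℕ → ℕ)
    (hmul : ∀ i < a, CanMultiply b f F (2 ^ i) (cost i)) (h : Reach n b f T J)
    (M : X → Matrix (Fin n) (Fin n) F)
    (hM : ∀ v x y, J v x y → rowCol (M x) v = rowCol (M y) v) :
    Reach n b f (T + ∑ i ∈ Finset.range a, cost i)
      (fun v x y => J v x y ∧ ∀ i ≤ 2 ^ a, rowCol (M x ^ i) v = rowCol (M y ^ i) v) := by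
  induction a with
  | zero =>
    refine h.mono fun v x y hJ => ⟨hJ, fun i hi => ?_⟩
    rcases (show i = 0 ∨ i = 1 by rw [pow_zero] at hi; omega) with rfl | rfl
    · simp
    · simpa using hM v x y hJ
  | succ a ih =>
    have h₁ := ih fun i hi => hmul i (hi.trans (Nat.lt_succ_self a))
    -- Multiplying the top power by the exponents 1, …, 2^a doubles the range.
    have h₂ := hmul a (Nat.lt_succ_self a) _ _ (fun x _ => M x ^ 2 ^ a)
      (fun x i => M x ^ ((i : ℕ) + 1)) h₁
      (fun v x y hJ i => ⟨hJ.2 _ le_rfl, hJ.2 _ i.2⟩)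
    rw [add_assoc, ← Finset.sum_range_succ] at h₂
    refine h₂.mono fun v x y hJ => ⟨hJ.1.1, fun i hi => ?_⟩
    by_cases hia : i ≤ 2 ^ a
    · exact hJ.1.2 i hia
    · have := hJ.2 ⟨i - 2 ^ a - 1, by rw [pow_succ] at hi; omega⟩
      simp only [← pow_add] at this
      rwa [show 2 ^ a + (i - 2 ^ a - 1 + 1) = i by omega] at this

variable [Finite F] {s : ℕ}

/-- Every node learns the traces of the products of two families of matrices. -/
theorem Reach.traces (hs : Nat.card F ≤ 2 ^ (b * s)) (hn : 1 ≤ n) {h : ℕ} (hh : h * h ≤ 4 * n)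
    (hJ : Reach n b f T J) (A B : X → Fin h → Matrix (Fin n) (Fin n) F)
    (hA : ∀ v x y, J v x y → ∀ i, rowCol (A x i) v = rowCol (A y i) v)
    (hB : ∀ v x y, J v x y → ∀ i, rowCol (B x i) v = rowCol (B y i) v) :
    Reach n b f (T + 40 * s)
      (fun v x y => J v x y ∧ ∀ i j, (A x i * B x j).trace = (A y i * B y j).trace) := by
  obtain ⟨ρ, hρ⟩ := exists_balanced_map (Fin h × Fin h) hn
  have hcard : Nat.card (Fin h × Fin h) = h * h := by simp
  rw [hcard] at hρ
  have hid : ∀ v : Fin n, Nat.card {a : Fin n // id a = v} = 1 := fun v => by simp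
  have l₁ : ∀ v : Fin n, Nat.card {a : Fin n // id a = v} * Nat.card (Fin h × Fin h) ≤ 5 * n := by
    intro v
    rw [hid, hcard]; omega
  have l₂ : ∀ v : Fin n, Nat.card (Fin n) * Nat.card {z // ρ z = v} ≤ 5 * n := by
    intro v
    rw [Nat.card_fin, mul_comm]
    refine Nat.mul_le_mul_right n ((hρ v).trans (Nat.succ_le_succ (Nat.div_le_of_le_mul ?_)))
    omega
  -- Node `l` holds row `l` of the left factor and column `l` of the right one, hence the `l`-th
  -- diagonal entry of each product. Node `ρ z` adds these up and then broadcasts the trace.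
  have r₁ := hJ.routeProd hs 5 id ρ l₁ l₂ (fun x l z => ∑ m, A x z.1 l m * B x z.2 m l) (by
    intro l x y (h : J l x y)
    funext z
    refine Finset.sum_congr rfl fun m _ => ?_
    rw [(rowCol_eq_iff.1 (hA _ _ _ h z.1)).1, (rowCol_eq_iff.1 (hB _ _ _ h z.2)).2])
  have r₂ := r₁.routeProd hs 5 ρ id (fun v => (mul_comm _ _).trans_le (l₂ v))
    (fun v => (mul_comm _ _).trans_le (l₁ v)) (fun x z _ => (A x z.1 * B x z.2).trace) (by
    intro z x y h
    funext _
    simp only [Matrix.trace, Matrix.diag_apply, Matrix.mul_apply]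
    exact Finset.sum_congr rfl fun l _ => h.2 l z rfl)
  exact (r₂.le (le_of_eq (by ring))).mono fun v x y h => ⟨h.1.1, fun i j => h.2 (i, j) v rfl⟩

end Powers

theorem Finset.sum_range_mul_eq {M : Type*} [AddCommMonoid M] (g : ℕ → M) (h l : ℕ) :
    ∑ k ∈ Finset.range (h * l), g k = ∑ j : Fin l, ∑ i ∈ Finset.range h, g (i + h * j) := by
  rw [Fin.sum_univ_eq_sum_range (fun j => ∑ i ∈ Finset.range h, g (i + h * j))]
  induction l with
  | zero => simp
  | succ l ih =>
    rw [Finset.sum_range_succ, ← ih, mul_add, mul_one, Finset.sum_range_add]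
    simp only [add_comm]

/-- Determinant and inverse by means of simultaneous matrix products. The powers of the matrix `A`
are written as products of one of the first `2 ^ a` powers of `A` and one of the first `2 ^ a` powers
of `A ^ 2 ^ a`. -/
theorem det_inv_of_canMultiply {n b s : ℕ} {F : Type*} [Field F] [Finite F] (hn : 1 ≤ n)
    (hs : Nat.card F ≤ 2 ^ (b * s)) (hchar : n < ringChar F) {a : ℕ} (ha : 2 ^ a * 2 ^ a ≤ 4 * n)
    (ha' : n ≤ 2 ^ a * 2 ^ a) (cost : ℕ → ℕ)
    (hmul : ∀ i ≤ a, CanMultiply b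
      (rowCol : Matrix (Fin n) (Fin n) F → Fin n → (Fin n → F) × (Fin n → F)) F (2 ^ i) (cost i)) :
    DetInRounds n b F (2 * (∑ i ∈ Finset.range a, cost i) + 40 * s + cost a) ∧
    InvInRounds n b F (2 * (∑ i ∈ Finset.range a, cost i) + 40 * s + cost a) := by
  set h := 2 ^ a with hh
  have hpos : 0 < h := by positivity
  have r₁ := (Reach.zero (n := n) (b := b) rowCol).powers a cost (fun i hi => hmul i hi.le)
    (fun x : Matrix (Fin n) (Fin n) F => x) (fun v x y hJ => hJ)
  have r₂ := r₁.powers a cost (fun i hi => hmul i hi.le) (fun x => x ^ h)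
    (fun v x y hJ => hJ.2 h le_rfl)
  have r₃ := r₂.traces hs hn ha (fun x i => x ^ ((i : ℕ) + 1)) (fun x j => (x ^ h) ^ (j : ℕ))
    (fun v x y hJ i => hJ.1.2 _ i.2) (fun v x y hJ j => hJ.2 _ j.2.le)
  have r₄ := r₃.mono (J' := fun v x y => x.charpoly = y.charpoly ∧
      (∀ i ≤ h, rowCol (x ^ i) v = rowCol (y ^ i) v) ∧
      (∀ i ≤ h, rowCol ((x ^ h) ^ i) v = rowCol ((y ^ h) ^ i) v)) (fun v x y hJ => by
    refine ⟨Matrix.charpoly_eq_of_trace_pow_eq hchar x y fun i hi => ?_, hJ.1.1.2, hJ.1.2⟩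
    have := hJ.2 ⟨i % h, Nat.mod_lt _ hpos⟩
      ⟨i / h, Nat.div_lt_of_lt_mul (hi.trans_le ha')⟩
    simp only [← pow_mul, ← pow_add] at this
    rwa [show i % h + 1 + h * (i / h) = i + 1 by have := Nat.mod_add_div i h; omega] at this)
  have hB : ∀ (v : Fin n) (x y : Matrix (Fin n) (Fin n) F), x.charpoly = y.charpoly →
      (∀ i ≤ h, rowCol (x ^ i) v = rowCol (y ^ i) v) → ∀ j : ℕ,
      rowCol (∑ i ∈ Finset.range h, invCoeff x.charpoly (i + h * j) • x ^ i) v =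
      rowCol (∑ i ∈ Finset.range h, invCoeff y.charpoly (i + h * j) • y ^ i) v := by
    intro v x y hxy hJ j
    rw [rowCol_eq_iff, hxy]
    simp only [Matrix.sum_apply, Matrix.smul_apply]
    constructor <;>
    · intro l
      refine Finset.sum_congr rfl fun i hi => ?_
      have := rowCol_eq_iff.1 (hJ i (Finset.mem_range.1 hi).le)
      simp only [this.1, this.2]
  have r₅ := hmul a le_rfl _ _ (fun x j => (x ^ h) ^ (j : ℕ))
    (fun x j => ∑ i ∈ Finset.range h, invCoeff x.charpoly (i + h * j) • x ^ i) r₄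
    (fun v x y hJ j => ⟨hJ.2.2 j j.2.le, hB v x y hJ.1 hJ.2.1 j⟩)
  rw [zero_add, ← two_mul] at r₅
  constructor
  · have : Nonempty F := ⟨0⟩
    refine Reach.exists_result (X := Matrix (Fin n) (Fin n) F) (g := fun x _ => x.det)
      (r₅.mono fun v x y hJ => ?_)
    rw [Matrix.det_eq_sign_charpoly_coeff, hJ.1.1, ← Matrix.det_eq_sign_charpoly_coeff]
  · have : Nonempty ((Fin n → F) × (Fin n → F)) := ⟨0⟩
    -- The protocol runs on singular matrices too, so its output is described by a formula valid for
    -- all of them; it is the inverse only for units.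
    obtain ⟨Q, hQ⟩ : ∃ Q : Matrix (Fin n) (Fin n) F → Matrix (Fin n) (Fin n) F, ∀ x,
      Q x = ∑ k ∈ Finset.range (h * h), invCoeff x.charpoly k • x ^ k := ⟨_, fun _ => rfl⟩
    have e : ∀ x, Q x = ∑ j : Fin h, (x ^ h) ^ (j : ℕ) *
        ∑ i ∈ Finset.range h, invCoeff x.charpoly (i + h * j) • x ^ i := by
      intro x
      rw [hQ, Finset.sum_range_mul_eq]
      refine Finset.sum_congr rfl fun j _ => ?_
      rw [Finset.mul_sum]
      refine Finset.sum_congr rfl fun i _ => ?_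
      rw [mul_smul_comm, ← pow_mul, ← pow_add, add_comm i]
    obtain ⟨p, hp⟩ := Reach.exists_result (X := Matrix (Fin n) (Fin n) F)
      (g := fun x v => rowCol (Q x) v) (r₅.mono fun v x y hJ => by
        rw [e, e, rowCol_eq_iff]
        simp only [Matrix.sum_apply]
        exact ⟨fun l => Finset.sum_congr rfl fun j _ => (rowCol_eq_iff.1 (hJ.2 j)).1 l,
          fun l => Finset.sum_congr rfl fun j _ => (rowCol_eq_iff.1 (hJ.2 j)).2 l⟩)
    refine ⟨p, fun A hA v => ?_⟩
    rw [hp, hQ, ← Matrix.inv_eq_sum_invCoeff A hA _ ha']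

/-! ### Exponents and round counts -/

/-- The schoolbook algorithm for matrix multiplication. -/
theorem hasMatMulAlgorithm_cube (F : Type*) [Field F] (d : ℕ) :
    HasMatMulAlgorithm F d d (d * (d * d)) := by
  classical
  let e : Fin (d * (d * d)) ≃ Fin d × Fin d × Fin d :=
    finProdFinEquiv.symm.trans ((Equiv.refl _).prodCongr finProdFinEquiv.symm)
  refine ⟨fun i j μ => if (e μ).1 = i ∧ (e μ).2.1 = j then 1 else 0,
    fun i j μ => if (e μ).2.2 = i ∧ (e μ).2.1 = j then 1 else 0,
    fun i j μ => if (e μ).1 = i ∧ (e μ).2.2 = j then 1 else 0, fun A B i j => ?_⟩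
  have hsum : ∀ (M : Matrix (Fin d) (Fin d) F) (a b : Fin d),
      ∑ i', ∑ j', (if a = i' ∧ b = j' then (1 : F) else 0) * M i' j' = M a b := by
    intro M a b
    simp [ite_and]
  have hsum' : ∀ (M : Matrix (Fin d) (Fin d) F) (a b : Fin d),
      ∑ i', ∑ j', (if a = i' ∧ b = j' then (1 : F) else 0) * M j' i' = M b a :=
    fun M a b => hsum Mᵀ a b
  simp only [hsum, hsum']
  rw [← e.symm.sum_comp]
  simp only [Equiv.apply_symm_apply, Fintype.sum_prod_type]
  simp [ite_and, Matrix.mul_apply]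

section Exponents

variable {ι : Type*} (F : ι → Type*) [∀ i, Field (F i)]

theorem three_mem_matMulExponents : (3 : ℝ) ∈ matMulExponents F := by
  refine ⟨1, fun i d _ => ⟨d * (d * d), le_of_eq ?_, hasMatMulAlgorithm_cube _ d⟩⟩
  rw [show (3 : ℝ) = ((3 : ℕ) : ℝ) by norm_num, Real.rpow_natCast]
  push_cast
  ring

variable {F}

/-- Rank at least d² contradicts O(d^τ) for τ < 2. The bound 2/τ ≤ 1 is what the choice of block
size rests on. -/
theorem two_le_of_mem_matMulExponents [Nonempty ι] {τ : ℝ} (hτ : τ ∈ matMulExponents F) :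
    2 ≤ τ := by
  obtain ⟨K, hK⟩ := hτ
  by_contra! h
  have hlim : Filter.Tendsto (fun d : ℕ => (d : ℝ) ^ (2 - τ)) Filter.atTop Filter.atTop :=
    (tendsto_rpow_atTop (by linarith)).comp tendsto_natCast_atTop_atTop
  obtain ⟨d, hd, hd₁⟩ := ((hlim.eventually_gt_atTop K).and (Filter.eventually_ge_atTop 1)).exists
  obtain ⟨t, ht, halg⟩ := hK (Classical.arbitrary ι) d hd₁
  have hd₀ : (0 : ℝ) < d := by exact_mod_cast hd₁
  have h₁ : (d : ℝ) ^ (2 : ℝ) ≤ K * (d : ℝ) ^ τ := by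
    refine le_trans ?_ ht
    rw [Real.rpow_two]
    exact_mod_cast halg.sq_le
  rw [Real.rpow_sub hd₀, lt_div_iff₀ (Real.rpow_pos_of_pos hd₀ _)] at hd
  linarith

end Exponents

/-- The order of the matrix multiplication algorithm used for `k` products. -/
theorem exists_block_size {τ : ℝ} (hτ : 2 ≤ τ) {n k : ℕ} (hk : 1 ≤ k) (hkn : k ≤ n) :
    ∃ d : ℕ, 1 ≤ d ∧ d * d ≤ n ∧ k * (d : ℝ) ^ τ ≤ n ∧
      1 ≤ 4 * ((d : ℝ) * d) * ((k : ℝ) / n) ^ (2 / τ) := by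
  have hk₀ : (0 : ℝ) < k := by exact_mod_cast hk
  have hn₀ : (0 : ℝ) < n := by exact_mod_cast hk.trans hkn
  have hk₁ : (1 : ℝ) ≤ k := by exact_mod_cast hk
  have hτ₀ : 0 < τ := by linarith
  have hy : (1 : ℝ) ≤ n / k := by
    rw [one_le_div hk₀]; exact_mod_cast hkn
  set y : ℝ := n / k with hy_def
  -- `x` solves k·x^τ = n, and `d` is its floor; the factor 4 in the last claim comes from x < d + 1
  -- ≤ 2d.
  set x : ℝ := y ^ (1 / τ) with hx
  have hx₁ : 1 ≤ x := Real.one_le_rpow hy (by positivity)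
  have hxsq : x * x = y ^ (2 / τ) := by
    rw [hx, ← Real.rpow_add (by linarith)]
    congr 1
    ring
  have hfl : (⌊x⌋₊ : ℝ) ≤ x := Nat.floor_le (by linarith)
  have hfl' : x < ⌊x⌋₊ + 1 := Nat.lt_floor_add_one x
  have hd : 1 ≤ ⌊x⌋₊ := Nat.le_floor (by simpa using hx₁)
  have hd' : (1 : ℝ) ≤ ⌊x⌋₊ := by exact_mod_cast hd
  refine ⟨⌊x⌋₊, hd, ?_, ?_, ?_⟩
  · have : (⌊x⌋₊ : ℝ) * ⌊x⌋₊ ≤ n := by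
      calc (⌊x⌋₊ : ℝ) * ⌊x⌋₊ ≤ x * x := by gcongr
        _ = y ^ (2 / τ) := hxsq
        _ ≤ y ^ (1 : ℝ) := Real.rpow_le_rpow_of_exponent_le hy (by rw [div_le_one hτ₀]; exact hτ)
        _ = n / k := Real.rpow_one _
        _ ≤ n := div_le_self hn₀.le hk₁
    exact_mod_cast this
  · calc (k : ℝ) * (⌊x⌋₊ : ℝ) ^ τ ≤ k * x ^ τ := by gcongr
      _ = k * y := by
        rw [hx, ← Real.rpow_mul (by linarith), one_div_mul_cancel hτ₀.ne', Real.rpow_one]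
      _ = n := by rw [hy_def]; field_simp
  · have h₁ : ((k : ℝ) / n) ^ (2 / τ) = (x * x)⁻¹ := by
      rw [hxsq, ← Real.inv_rpow (by linarith), hy_def, inv_div]
    rw [h₁, ← div_eq_mul_inv, one_le_div (by positivity)]
    nlinarith

/-- The number of rounds for `k` simultaneous matrix products. -/
theorem exists_canMultiply {τ : ℝ} (hτ : 2 ≤ τ) {F : Type*} [Field F] [Finite F] {K : ℝ}
    (halg : ∀ d : ℕ, 1 ≤ d → ∃ t : ℕ, (t : ℝ) ≤ K * (d : ℝ) ^ τ ∧ HasMatMulAlgorithm F d d t)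
    {n b s : ℕ} (hs : Nat.card F ≤ 2 ^ (b * s)) {X In : Type*} (f : X → Fin n → In)
    {k : ℕ} (hk : 1 ≤ k) (hkn : k ≤ n) :
    ∃ c : ℕ, (c : ℝ) ≤ (80 + 240 * (⌈K⌉₊ + 1)) * s * (n * ((k : ℝ) / n) ^ (2 / τ)) ∧
      CanMultiply b f F k c := by
  obtain ⟨d, hd, hdn, hkd, hd4⟩ := exists_block_size hτ hk hkn
  obtain ⟨t, ht, h⟩ := halg d hd
  have hn : 1 ≤ n := hk.trans hkn
  have hk₀ : (0 : ℝ) < k := by exact_mod_cast hk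
  have hn₀ : (0 : ℝ) < n := by exact_mod_cast hn
  have hd₀ : (0 : ℝ) < d := by exact_mod_cast hd
  have hR : k * t ≤ ⌈K⌉₊ * n := by
    have : (k : ℝ) * t ≤ ⌈K⌉₊ * n := by
      calc (k : ℝ) * t ≤ k * (⌈K⌉₊ * (d : ℝ) ^ τ) := by
            gcongr
            exact ht.trans (by gcongr; exact Nat.le_ceil K)
        _ = ⌈K⌉₊ * (k * (d : ℝ) ^ τ) := by ring
        _ ≤ ⌈K⌉₊ * n := by gcongr
    exact_mod_cast this
  refine ⟨_, ?_, fun T J A B hJ hAB => hJ.matMul hs hn hd hdn hR h A B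
    (fun v x y hxy i => (rowCol_eq_iff.1 (hAB v x y hxy i).1).1)
    (fun v x y hxy i => (rowCol_eq_iff.1 (hAB v x y hxy i).2).1)⟩
  set z : ℝ := ((k : ℝ) / n) ^ (2 / τ) with hz
  have hz₀ : 0 < z := Real.rpow_pos_of_pos (by positivity) _
  -- Moving inputs and outputs costs O(k), which this absorbs because k/n ≤ 1 and 2/τ ≤ 1.
  have hkz : (k : ℝ) ≤ n * z := by
    have h₁ : (k : ℝ) / n ≤ 1 := by
      rw [div_le_one hn₀]; exact_mod_cast hkn
    have h₂ : ((k : ℝ) / n) ^ (1 : ℝ) ≤ z :=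
      Real.rpow_le_rpow_of_exponent_ge (by positivity) h₁
        (by rw [div_le_one (by linarith)]; exact hτ)
    rw [Real.rpow_one, div_le_iff₀ hn₀] at h₂
    linarith
  have hdn' : (d : ℝ) * d ≤ n := by exact_mod_cast hdn
  have hW : (((n / d + 1) * (n / d + 1) / n + 1 : ℕ) : ℝ) ≤ 20 * (n * z) := by
    have h₁ : ((n / d + 1 : ℕ) : ℝ) ≤ 2 * (n / d) := by
      have h₂ : ((n / d : ℕ) : ℝ) ≤ n / d := Nat.cast_div_le
      have h₃ : (1 : ℝ) ≤ n / d := by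
        rw [one_le_div hd₀]
        have : d ≤ n := le_trans (Nat.le_mul_self d) hdn
        exact_mod_cast this
      push_cast
      linarith
    have h₄ : (1 : ℝ) ≤ n / (d * d) := by
      rwa [one_le_div (by positivity)]
    calc (((n / d + 1) * (n / d + 1) / n + 1 : ℕ) : ℝ)
        = (((n / d + 1) * (n / d + 1) / n : ℕ) : ℝ) + 1 := by push_cast; ring
      _ ≤ (((n / d + 1) * (n / d + 1) : ℕ) : ℝ) / n + 1 := by gcongr; exact Nat.cast_div_le
      _ = ((n / d + 1 : ℕ) : ℝ) * ((n / d + 1 : ℕ) : ℝ) / n + 1 := by rw [Nat.cast_mul]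
      _ ≤ (2 * (n / d)) * (2 * (n / d)) / n + 1 := by gcongr
      _ = 4 * (n / (d * d)) + 1 := by field_simp; ring
      _ ≤ 5 * (n / (d * d)) := by linarith
      _ ≤ 5 * (n / (d * d)) * (4 * ((d : ℝ) * d) * z) :=
          le_mul_of_one_le_right (by positivity) hd4
      _ = 20 * (n * z) := by field_simp; ring
  rw [Nat.cast_mul, Nat.cast_add, Nat.cast_mul, Nat.cast_mul 12, Nat.cast_mul (⌈K⌉₊ + 1)]
  calc _ ≤ ((80 : ℕ) * (n * z) + (12 : ℕ) * (((⌈K⌉₊ + 1 : ℕ) : ℝ) * (20 * (n * z)))) * s := by gcongr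
    _ = _ := by push_cast; ring

/-- The constant P(1) is at most n^P(1) once n ≥ 2. With such an `s`, a field element fits into `s`
messages. -/
theorem Polynomial.exists_eval_le_pow (P : Polynomial ℕ) :
    ∃ s : ℕ, ∀ n : ℕ, 2 ≤ n → P.eval n ≤ n ^ s := by
  refine ⟨P.eval 1 + P.natDegree, fun n hn => ?_⟩
  have h₁ : P.eval n ≤ P.eval 1 * n ^ P.natDegree := by
    rw [eval_eq_sum_range, eval_eq_sum_range, Finset.sum_mul]
    refine Finset.sum_le_sum fun i hi => ?_
    rw [one_pow, mul_one]
    exact Nat.mul_le_mul_left _ (Nat.pow_le_pow_right (by omega)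
      (Nat.lt_succ_iff.1 (Finset.mem_range.1 hi)))
  rw [pow_add]
  exact h₁.trans (Nat.mul_le_mul_right _ (Nat.lt_pow_self hn).le)

/-- 4^a is the least power of 4 that is at least n. -/
theorem exists_sqrt_two_pow {n : ℕ} (hn : 1 ≤ n) :
    ∃ a : ℕ, 2 ^ a * 2 ^ a ≤ 4 * n ∧ n ≤ 2 ^ a * 2 ^ a ∧ 2 ^ a ≤ n := by
  have h4 : ∀ a : ℕ, 2 ^ a * 2 ^ a = 4 ^ a := fun a => by rw [← mul_pow]; norm_num
  simp only [h4]
  obtain ⟨a, ha⟩ : ∃ a, a = Nat.clog 4 n := ⟨_, rfl⟩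
  have h₁ : n ≤ 4 ^ a := ha ▸ Nat.le_pow_clog (by norm_num) n
  have h₂ : 4 ^ a ≤ 4 * n := by
    rcases a with _ | a
    · simpa using by omega
    · have := (Nat.lt_clog_iff_pow_lt (b := 4) (by norm_num)).1 (show a < Nat.clog 4 n by omega)
      rw [pow_succ]; omega
  refine ⟨a, h₂, h₁, ?_⟩
  rcases a with _ | _ | a
  · simpa using hn
  · have := (Nat.lt_clog_iff_pow_lt (b := 4) (by norm_num)).1 (show 0 < Nat.clog 4 n by omega)
    norm_num at this ⊢
    omega
  · rw [← h4] at h₂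
    have : 4 ≤ 2 ^ (a + 2) := by rw [pow_add]; have := Nat.one_le_two_pow (n := a); omega
    nlinarith

/-- Determinant and inverse of `1 × 1` matrices without communication. -/
theorem det_inv_one (b : ℕ) (F : Type*) [Field F] : DetInRounds 1 b F 0 ∧ InvInRounds 1 b F 0 := by
  have h : ∀ (v : Fin 1) (A B : Matrix (Fin 1) (Fin 1) F), rowCol A v = rowCol B v → A = B := by
    intro v A B hAB
    ext i j
    rw [Subsingleton.elim i v]
    exact (rowCol_eq_iff.1 hAB).1 j
  constructor
  · have : Nonempty F := ⟨0⟩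
    exact Reach.exists_result (X := Matrix (Fin 1) (Fin 1) F) (g := fun x _ => x.det)
      ((Reach.zero rowCol).mono fun v x y hxy => by rw [h v x y hxy])
  · have : Nonempty ((Fin 1 → F) × (Fin 1 → F)) := ⟨0⟩
    obtain ⟨p, hp⟩ := Reach.exists_result (n := 1) (b := b) (T := 0)
      (X := Matrix (Fin 1) (Fin 1) F) (g := fun x v => rowCol x⁻¹ v)
      ((Reach.zero rowCol).mono fun v x y hxy => by rw [h v x y hxy])
    exact ⟨p, fun A _ v => hp A v⟩

/-- The round complexity in terms of a common exponent of the ranks over the field. -/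
theorem exists_rounds_of_exponent {τ : ℝ} (hτ : 2 ≤ τ) (K : ℝ) (s : ℕ) :
    ∃ C : ℝ, ∀ (n b : ℕ) (F : Type*) [Field F] [Finite F], 1 ≤ n → Nat.card F ≤ 2 ^ (b * s) →
      n < ringChar F →
      (∀ d : ℕ, 1 ≤ d → ∃ t : ℕ, (t : ℝ) ≤ K * (d : ℝ) ^ τ ∧ HasMatMulAlgorithm F d d t) →
      ∃ T : ℕ, (T : ℝ) ≤ C * (n : ℝ) ^ (1 - 1 / τ) ∧ DetInRounds n b F T ∧ InvInRounds n b F T := by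
  have hτ₀ : 0 < τ := by linarith
  -- The ratio between the cost bounds of consecutive doublings; ρ > 1 lets the last stage dominate.
  set ρ : ℝ := 2 ^ (2 / τ) with hρ
  have hρ₁ : 1 < ρ := Real.one_lt_rpow (by norm_num) (by positivity)
  have hρ₂ : ρ ≤ 2 := by
    calc ρ ≤ 2 ^ (1 : ℝ) := Real.rpow_le_rpow_of_exponent_le (by norm_num)
          (by rw [div_le_one hτ₀]; exact hτ)
      _ = 2 := Real.rpow_one 2
  set C₀ : ℝ := (80 + 240 * (⌈K⌉₊ + 1)) * s with hC₀
  refine ⟨C₀ * (2 * (1 / (ρ - 1)) + 1) * 2 + 40 * s, fun n b F _ _ hn hs hchar halg => ?_⟩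
  obtain ⟨a, ha, ha', han⟩ := exists_sqrt_two_pow hn
  have hn₀ : (0 : ℝ) < n := by exact_mod_cast hn
  have hn₁ : (1 : ℝ) ≤ n := by exact_mod_cast hn
  have hcost : ∀ i : ℕ, ∃ c : ℕ, i ≤ a →
      (c : ℝ) ≤ C₀ * (n * (((2 ^ i : ℕ) : ℝ) / n) ^ (2 / τ)) ∧ CanMultiply b
        (rowCol : Matrix (Fin n) (Fin n) F → Fin n → (Fin n → F) × (Fin n → F)) F (2 ^ i) c := by
    intro i
    by_cases hi : i ≤ a
    · obtain ⟨c, hc⟩ := exists_canMultiply hτ halg hs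
        (rowCol : Matrix (Fin n) (Fin n) F → Fin n → (Fin n → F) × (Fin n → F))
        (k := 2 ^ i) Nat.one_le_two_pow
        ((Nat.pow_le_pow_right (by norm_num) hi).trans han)
      exact ⟨c, fun _ => hc⟩
    · exact ⟨0, fun h => absurd h hi⟩
  choose cost hcost using hcost
  refine ⟨_, ?_, det_inv_of_canMultiply hn hs hchar ha ha' cost fun i hi => (hcost i hi).2⟩
  have hpow : ∀ i : ℕ, ((2 : ℝ) ^ i) ^ (2 / τ) = ρ ^ i := by
    intro i
    rw [hρ, ← Real.rpow_natCast, ← Real.rpow_mul (by norm_num), mul_comm, Real.rpow_mul (by norm_num),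
      Real.rpow_natCast]
  have hbound : ∀ i ≤ a, (cost i : ℝ) ≤ C₀ * ((n : ℝ) ^ (1 - 2 / τ) * ρ ^ i) := by
    intro i hi
    refine (hcost i hi).1.trans_eq ?_
    push_cast
    rw [Real.div_rpow (by positivity) hn₀.le, hpow, Real.rpow_sub hn₀, Real.rpow_one]
    ring
  have hmain : (n : ℝ) ^ (1 - 2 / τ) * ρ ^ a ≤ 2 * (n : ℝ) ^ (1 - 1 / τ) := by
    have h₁ : ((2 : ℝ) ^ a * 2 ^ a) ≤ 4 * n := by exact_mod_cast ha
    have h₂ : ρ ^ a ≤ 2 * (n : ℝ) ^ (1 / τ) := by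
      calc ρ ^ a = ((2 : ℝ) ^ a * 2 ^ a) ^ (1 / τ) := by
            rw [← hpow, Real.mul_rpow (by positivity) (by positivity),
              ← Real.rpow_add (by positivity)]
            congr 1
            ring
        _ ≤ (4 * n) ^ (1 / τ) := by gcongr
        _ = ρ * (n : ℝ) ^ (1 / τ) := by
            rw [Real.mul_rpow (by norm_num) hn₀.le, hρ, show (4 : ℝ) = 2 ^ (2 : ℝ) by norm_num,
              ← Real.rpow_mul (by norm_num), mul_one_div]
        _ ≤ 2 * (n : ℝ) ^ (1 / τ) := by gcongr
    calc (n : ℝ) ^ (1 - 2 / τ) * ρ ^ a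
        ≤ (n : ℝ) ^ (1 - 2 / τ) * (2 * (n : ℝ) ^ (1 / τ)) := by gcongr
      _ = 2 * ((n : ℝ) ^ (1 - 2 / τ) * (n : ℝ) ^ (1 / τ)) := by ring
      _ = 2 * (n : ℝ) ^ (1 - 1 / τ) := by
          rw [← Real.rpow_add hn₀]
          congr 2
          ring
  have hsum : ((∑ i ∈ Finset.range a, cost i : ℕ) : ℝ) ≤
      C₀ * ((n : ℝ) ^ (1 - 2 / τ) * ρ ^ a) * (1 / (ρ - 1)) := by
    push_cast
    calc ∑ i ∈ Finset.range a, (cost i : ℝ)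
        ≤ ∑ i ∈ Finset.range a, C₀ * ((n : ℝ) ^ (1 - 2 / τ) * ρ ^ i) :=
          Finset.sum_le_sum fun i hi => hbound i (Finset.mem_range.1 hi).le
      _ = C₀ * ((n : ℝ) ^ (1 - 2 / τ) * ((ρ ^ a - 1) / (ρ - 1))) := by
          rw [← Finset.mul_sum, ← Finset.mul_sum, geom_sum_eq hρ₁.ne']
      _ ≤ C₀ * ((n : ℝ) ^ (1 - 2 / τ) * (ρ ^ a / (ρ - 1))) := by
          have : 0 < ρ - 1 := by linarith
          gcongr
          linarith
      _ = _ := by ring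
  have hone : (1 : ℝ) ≤ (n : ℝ) ^ (1 - 1 / τ) :=
    Real.one_le_rpow hn₁ (by rw [sub_nonneg, div_le_one hτ₀]; linarith)
  have hρ₀ : 0 ≤ 1 / (ρ - 1) := by
    have : 0 < ρ - 1 := by linarith
    positivity
  rw [Nat.cast_add, Nat.cast_add, Nat.cast_mul, Nat.cast_mul]
  calc ((2 : ℕ) : ℝ) * ((∑ i ∈ Finset.range a, cost i : ℕ) : ℝ) + ((40 : ℕ) : ℝ) * s + cost a
      ≤ 2 * (C₀ * ((n : ℝ) ^ (1 - 2 / τ) * ρ ^ a) * (1 / (ρ - 1))) + 40 * s +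
        C₀ * ((n : ℝ) ^ (1 - 2 / τ) * ρ ^ a) := by
        push_cast at hsum ⊢
        linarith [hbound a le_rfl]
    _ = C₀ * (2 * (1 / (ρ - 1)) + 1) * ((n : ℝ) ^ (1 - 2 / τ) * ρ ^ a) + 40 * s * 1 := by ring
    _ ≤ C₀ * (2 * (1 / (ρ - 1)) + 1) * (2 * (n : ℝ) ^ (1 - 1 / τ)) +
        40 * s * (n : ℝ) ^ (1 - 1 / τ) := by gcongr
    _ = _ := by ring

theorem theorem2 (β : ℕ) (hβ : 1 ≤ β) (P : Polynomial ℕ)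
    {ι : Type*} (n : ι → ℕ) (hn : ∀ i, 1 ≤ n i)
    (F : ι → Type*) [∀ i, Field (F i)] [∀ i, Finite (F i)]
    (hcard : ∀ i, Nat.card (F i) ≤ P.eval (n i))
    (hchar : ∀ i, n i < ringChar (F i)) :
    (∀ τ ∈ matMulExponents F, ∃ C : ℝ, ∀ i, ∃ T : ℕ,
      (T : ℝ) ≤ C * (n i : ℝ) ^ (1 - 1 / τ) ∧
      DetInRounds (n i) (β * Nat.clog 2 (n i)) (F i) T ∧
      InvInRounds (n i) (β * Nat.clog 2 (n i)) (F i) T) ∧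
    (∀ ε : ℝ, 0 < ε → ∃ C : ℝ, ∀ i, ∃ T : ℕ,
      (T : ℝ) ≤ C * (n i : ℝ) ^ (1 - 1 / matMulOmega F + ε) ∧
      DetInRounds (n i) (β * Nat.clog 2 (n i)) (F i) T ∧
      InvInRounds (n i) (β * Nat.clog 2 (n i)) (F i) T) := by
  have main : ∀ τ ∈ matMulExponents F, ∃ C : ℝ, ∀ i, ∃ T : ℕ,
      (T : ℝ) ≤ C * (n i : ℝ) ^ (1 - 1 / τ) ∧
      DetInRounds (n i) (β * Nat.clog 2 (n i)) (F i) T ∧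
      InvInRounds (n i) (β * Nat.clog 2 (n i)) (F i) T := by
    intro τ hτ
    rcases isEmpty_or_nonempty ι with hι | hι
    · exact ⟨0, fun i => hι.elim i⟩
    have hτ₂ := two_le_of_mem_matMulExponents hτ
    obtain ⟨K, hK⟩ := hτ
    obtain ⟨s, hs⟩ := P.exists_eval_le_pow
    obtain ⟨C, hC⟩ := exists_rounds_of_exponent hτ₂ K s
    refine ⟨max C 0, fun i => ?_⟩
    -- For n = 1 messages have no bits, so this case must do without communication.
    rcases (hn i).eq_or_lt with h1 | h2
    · rw [← h1]
      exact ⟨0, by simp, det_inv_one _ _⟩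
    · obtain ⟨T, hT, h⟩ := hC (n i) (β * Nat.clog 2 (n i)) (F i) (hn i) (by
        calc Nat.card (F i) ≤ n i ^ s := (hcard i).trans (hs _ h2)
          _ ≤ (2 ^ Nat.clog 2 (n i)) ^ s :=
            Nat.pow_le_pow_left (Nat.le_pow_clog (by norm_num) _) _
          _ = 2 ^ (Nat.clog 2 (n i) * s) := (pow_mul _ _ _).symm
          _ ≤ 2 ^ (β * Nat.clog 2 (n i) * s) := Nat.pow_le_pow_right (by norm_num)
            (Nat.mul_le_mul_right _ (Nat.le_mul_of_pos_left _ hβ))) (hchar i) (hK i)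
      exact ⟨T, hT.trans (by gcongr; exact le_max_left _ _), h⟩
  refine ⟨main, fun ε hε => ?_⟩
  rcases isEmpty_or_nonempty ι with hι | hι
  · exact ⟨0, fun i => hι.elim i⟩
  have hne : (matMulExponents F).Nonempty := ⟨3, three_mem_matMulExponents F⟩
  have hω : 2 ≤ matMulOmega F := le_csInf hne fun τ hτ => two_le_of_mem_matMulExponents hτ
  obtain ⟨τ, hτ, hlt⟩ := exists_lt_of_csInf_lt hne (show sInf (matMulExponents F) <
    matMulOmega F + ε from lt_add_of_pos_right _ hε)
  have hτ₂ := two_le_of_mem_matMulExponents hτ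
  obtain ⟨C, hC⟩ := main τ hτ
  refine ⟨max C 0, fun i => ?_⟩
  obtain ⟨T, hT, h⟩ := hC i
  have hn₁ : (1 : ℝ) ≤ n i := by exact_mod_cast hn i
  have hexp : 1 - 1 / τ ≤ 1 - 1 / matMulOmega F + ε := by
    -- The difference is (τ - ω)/(ωτ), with τ - ω < ε and ωτ ≥ 4.
    have h₁ : 1 / matMulOmega F - 1 / τ ≤ ε := by
      rw [div_sub_div _ _ (by linarith) (by linarith), div_le_iff₀ (by nlinarith)]
      nlinarith [mul_le_mul hω hτ₂ (by norm_num) (by linarith)]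
    linarith
  refine ⟨T, hT.trans ?_, h⟩
  calc C * (n i : ℝ) ^ (1 - 1 / τ) ≤ max C 0 * (n i : ℝ) ^ (1 - 1 / τ) := by
        gcongr; exact le_max_left _ _
    _ ≤ _ := by gcongr
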